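/- For a permutation $\pi$ of $\{1,\dots,n\}$ write $|\pi|=n$. Let $\mathrm{fp}(\pi)$, $\mathrm{exc}(\pi)$ and $\mathrm{dexc}(\pi)$ be the numbers of indices $i$ with $\pi(i)=i$, with $i<\pi(i)$, and with $i<\pi(i)<\pi(\pi(i))$, respectively, and let $\mathrm{cyc}(\pi)$ be the number of cycles of $\pi$, fixed points included. Say that $\pi$ has increasing excedances if $\pi(i)<\pi(j)$ whenever $i<j$, $i<\pi(i)$ and $j<\pi(j)$, and that $\pi$ is cyclic if $\mathrm{cyc}(\pi)=1$. Let $\mathcal{I}$ be the set of permutations (of all lengths $n\ge 0$) with increasing excedances, let $\mathcal{CI}\subset\mathcal{I}$ be the subset of cyclic ones, and let $\mathcal{CI}_n$ be the set of $\pi\in\mathcal{CI}$ with $|\pi|=n$. For sequences $\mathbf d=(d_1,d_2,\dots)$ and $\boldsymbol\ell=(\ell_0,\ell_1,\dots)$ in a commutative ring let $$J_{\mathbf d,\boldsymbol\ell}(z)=\cfrac{1}{1-\ell_0z-\cfrac{d_1z^2}{1-\ell_1z-\cfrac{d_2z^2}{\ddots}}},\qquad K_{\mathbf d,\boldsymbol\ell}(z)=\ell_0z+\cfrac{d_1z^2}{1-\ell_1z-\cfrac{d_2z^2}{1-\ell_2z-\cfrac{d_3z^2}{\ddots}}}$$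 as formal power series in $z$ (the coefficientwise limits of the finite truncations). Then, with $x,v,w,t$ formal variables (equivalently, arbitrary elements of a commutative ring): 1. $$\sum_{\pi\in\mathcal{I}}x^{\mathrm{fp}(\pi)}v^{\mathrm{exc}(\pi)}w^{\mathrm{dexc}(\pi)}t^{\mathrm{cyc}(\pi)}z^{|\pi|}=J_{\mathbf d,\boldsymbol\ell}(z)$$ with $d_h=v(h-1+t)$ for $h\ge1$, $\ell_0=xt$, and $\ell_h=xt+vw+h$ for $h\ge1$. 2. $$\sum_{\pi\in\mathcal{CI}}x^{\mathrm{fp}(\pi)}v^{\mathrm{exc}(\pi)}w^{\mathrm{dexc}(\pi)}z^{|\pi|}=K_{\mathbf d,\boldsymbol\ell}(z)$$ with $d_1=v$, $d_h=(h-1)v$ for $h\ge2$, $\ell_0=x$, and $\ell_h=vw+h$ for $h\ge1$; and, with the number of cycles recorded as well, $$\sum_{\pi\in\mathcal{CI}}x^{\mathrm{fp}(\pi)}v^{\mathrm{exc}(\pi)}w^{\mathrm{dexc}(\pi)}t^{\mathrm{cyc}(\pi)}z^{|\pi|}=t\,K_{\mathbf d,\boldsymbol\ell}(z)$$ with the same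 $\mathbf d$ and $\boldsymbol\ell$. 3. $\sum_{n\ge1}|\mathcal{CI}_n|\,z^n=K_{\mathbf d,\boldsymbol\ell}(z)$ with $d_1=1$, $d_h=h-1$ for $h\ge2$, and $\ell_h=h+1$ for $h\ge0$, that is, $$\sum_{n\ge1}|\mathcal{CI}_n|\,z^n=z+\cfrac{z^2}{1-2z-\cfrac{z^2}{1-3z-\cfrac{2z^2}{1-4z-\cfrac{3z^2}{\ddots}}}}.$$ -/

import Mathlib

open PowerSeries

namespace PermStat

/-- Number of fixed points. -/
def fp {n : ℕ} (π : Equiv.Perm (Fin n)) : ℕ :=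
  (Finset.univ.filter fun i : Fin n => π i = i).card

/-- Number of excedances. An excedance is a value `π i` with `i < π i`; since `π` is injective,
these values are counted by their positions `i`. -/
def exc {n : ℕ} (π : Equiv.Perm (Fin n)) : ℕ :=
  (Finset.univ.filter fun i : Fin n => i < π i).card

/-- Number of double excedances: values `π i` with `i < π i < π (π i)`. -/
def dexc {n : ℕ} (π : Equiv.Perm (Fin n)) : ℕ :=
  (Finset.univ.filter fun i : Fin n => i < π i ∧ π i < π (π i)).card

/-- Number of cycles, fixed points included: the number of classes of the relation
"`i` and `j` lie in the same cycle of `π`". -/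
noncomputable def cyc {n : ℕ} (π : Equiv.Perm (Fin n)) : ℕ :=
  Nat.card (Quotient (Equiv.Perm.SameCycle.setoid π))

/-- The subsequence of the excedances of `π` is increasing. -/
def IncreasingExcedances {n : ℕ} (π : Equiv.Perm (Fin n)) : Prop :=
  ∀ i j : Fin n, i < j → i < π i → j < π j → π i < π j

/-- `π` consists of exactly one cycle (so the permutation of one point is cyclic, and the
permutation of the empty set is not). -/
def IsCyclic {n : ℕ} (π : Equiv.Perm (Fin n)) : Prop :=
  cyc π = 1

open Classical in
/-- The permutations of length `n` with increasing excedances. -/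
noncomputable def IE (n : ℕ) : Finset (Equiv.Perm (Fin n)) :=
  Finset.univ.filter fun π => IncreasingExcedances π

open Classical in
/-- The cyclic permutations of length `n` with increasing excedances. -/
noncomputable def CIE (n : ℕ) : Finset (Equiv.Perm (Fin n)) :=
  Finset.univ.filter fun π => IsCyclic π ∧ IncreasingExcedances π

variable {R : Type*} [CommRing R]

/-- The finite continued fraction
`1 / (1 - ℓ₀ z - d₁ z² / (1 - ℓ₁ z - d₂ z² / ( ⋯ / (1 - ℓ_{N-1} z))))` with `N` denominators,
as a formal power series in `z = X`. Every denominator has constant term `1`, so that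
`invOfUnit _ 1` is its true inverse. -/
noncomputable def jConvergent : ℕ → (ℕ → R) → (ℕ → R) → R⟦X⟧
  | 0, _, _ => 0
  | N + 1, d, l =>
      invOfUnit
        (1 - C (l 0) * X
          - C (d 1) * X ^ 2 * jConvergent N (fun h => d (h + 1)) (fun h => l (h + 1))) 1

/-- The J-fraction `1 / (1 - ℓ₀ z - d₁ z² / (1 - ℓ₁ z - d₂ z² / ⋱))` as a formal power series, the
coefficientwise limit of the finite continued fractions (see `coeff_jConvergent`). The entry
`d 0` is not used. -/
noncomputable def jFraction (d l : ℕ → R) : R⟦X⟧ :=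
  PowerSeries.mk fun n => coeff n (jConvergent (n + 1) d l)

/-- The elevated fraction `ℓ₀ z + d₁ z² / (1 - ℓ₁ z - d₂ z² / (1 - ℓ₂ z - d₃ z² / ⋱))`. -/
noncomputable def kFraction (d l : ℕ → R) : R⟦X⟧ :=
  C (l 0) * X + C (d 1) * X ^ 2 * jFraction (fun h => d (h + 1)) (fun h => l (h + 1))

theorem jConvergent_succ_mul (N : ℕ) (d l : ℕ → R) :
    (1 - C (l 0) * X
      - C (d 1) * X ^ 2 * jConvergent N (fun h => d (h + 1)) (fun h => l (h + 1)))
      * jConvergent (N + 1) d l = 1 := by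
  rw [jConvergent]
  apply mul_invOfUnit
  simp

theorem X_pow_dvd_jConvergent_sub (N : ℕ) (d l : ℕ → R) :
    (X : R⟦X⟧) ^ N ∣ jConvergent (N + 1) d l - jConvergent N d l := by
  induction N generalizing d l with
  | zero => simp
  | succ N ih =>
    obtain ⟨q, hq⟩ := ih (fun h => d (h + 1)) (fun h => l (h + 1))
    have h1 := jConvergent_succ_mul (N + 1) d l
    have h2 := jConvergent_succ_mul N d l
    refine ⟨jConvergent (N + 1 + 1) d l * jConvergent (N + 1) d l * C (d 1) * X * q, ?_⟩
    linear_combination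
      (jConvergent (N + 1) d l) * h1 - (jConvergent (N + 1 + 1) d l) * h2
        + jConvergent (N + 1 + 1) d l * jConvergent (N + 1) d l * C (d 1) * X ^ 2 * hq

/-- The coefficients of the finite continued fractions are eventually constant, with value the
coefficient of the J-fraction. -/
theorem coeff_jConvergent (d l : ℕ → R) (n N : ℕ) (h : n < N) :
    coeff n (jConvergent N d l) = coeff n (jFraction d l) := by
  induction N, h using Nat.le_induction with
  | base => simp [jFraction]
  | succ N hN ih =>
    rw [← ih, ← sub_eq_zero, ← map_sub]
    exact X_pow_dvd_iff.mp (X_pow_dvd_jConvergent_sub N d l) n hN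

end PermStat

/-!
Every permutation of `n + 1` points arises in a unique way from one of `n` points, by adding the
largest element either as a fixed point or directly after some `j` in the cycle of `j`. While a
permutation is built up in this way, mark the positions after which a larger element is still to be
inserted. The next insertion takes place after a marked position, which either keeps its mark or
releases it. A position that is released becomes an excedance whose value exceeds all earlier ones,
so the excedances of the final permutation increase exactly when each release is that of the
leftmost mark. Hence with `h + 1` marks there are `h + 1` insertions that keep the mark and a single
one that releases it. As the new element may be marked in turn, the number of marks moves like the
height of a weighted Motzkin path, and paths from height `0` to height `0` are counted by a
J-fraction.

For cyclic permutations, the factor `t` in `ℓ₀` and `d₁` shows that the J-fraction has the form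
`1 / (1 - t K)` over `R[t]`. Its coefficient of `t¹` is `K` at `t = 0`.
-/

namespace PermStat

section Fractions

variable {R : Type*} [CommRing R]

theorem X_pow_dvd_jFraction_sub_jConvergent (N : ℕ) (d l : ℕ → R) :
    (X : R⟦X⟧) ^ N ∣ jFraction d l - jConvergent N d l := by
  rw [X_pow_dvd_iff]
  intro m hm
  rw [map_sub, coeff_jConvergent d l m N hm, sub_self]

theorem one_sub_kFraction_mul_jFraction (d l : ℕ → R) :
    (1 - kFraction d l) * jFraction d l = 1 := by
  rw [← sub_eq_zero]
  ext n
  rw [map_zero]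
  suffices X ^ (n + 1) ∣ (1 - kFraction d l) * jFraction d l - 1 from
    X_pow_dvd_iff.mp this n n.lt_succ_self
  obtain ⟨p, hp⟩ := X_pow_dvd_jFraction_sub_jConvergent (n + 1)
    (fun h => d (h + 1)) (fun h => l (h + 1))
  obtain ⟨q, hq⟩ := X_pow_dvd_jFraction_sub_jConvergent (n + 1 + 1) d l
  have hconv := jConvergent_succ_mul (n + 1) d l
  refine ⟨(1 - kFraction d l) * X * q - C (d 1) * X ^ 2 * jConvergent (n + 1 + 1) d l * p, ?_⟩
  unfold kFraction
  linear_combination hconv - C (d 1) * X ^ 2 * jConvergent (n + 1 + 1) d l * hp +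
    (1 - C (l 0) * X - C (d 1) * X ^ 2 * jFraction (fun h => d (h + 1)) fun h => l (h + 1)) * hq

theorem jFraction_congr {d d' l l' : ℕ → R} (hd : ∀ h, d (h + 1) = d' (h + 1))
    (hl : ∀ h, l h = l' h) : jFraction d l = jFraction d' l' := by
  simp only [jFraction, jConvergent, hd, hl]

theorem kFraction_eq_C_mul {d d' l l' : ℕ → R} (c : R) (hl₀ : l 0 = c * l' 0)
    (hd₁ : d 1 = c * d' 1) (hd : ∀ h, d (h + 2) = d' (h + 2)) (hl : ∀ h, l (h + 1) = l' (h + 1)) :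
    kFraction d l = C c * kFraction d' l' := by
  rw [kFraction, kFraction, jFraction_congr (d' := fun h => d' (h + 1)) hd hl, hl₀, hd₁,
    map_mul, map_mul]
  ring

theorem kFraction_congr {d d' l l' : ℕ → R} (hd : ∀ h, d (h + 1) = d' (h + 1))
    (hl : ∀ h, l h = l' h) : kFraction d l = kFraction d' l' := by
  simpa using kFraction_eq_C_mul 1 (by simpa using hl 0) (by simpa using hd 0)
    (fun h => hd (h + 1)) (fun h => hl (h + 1))

section Map

variable {S : Type*} [CommRing S] (φ : R →+* S)

theorem map_jConvergent (N : ℕ) (d l : ℕ → R) :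
    PowerSeries.map φ (jConvergent N d l) = jConvergent N (φ ∘ d) (φ ∘ l) := by
  induction N generalizing d l with
  | zero => simp [jConvergent]
  | succ N ih =>
    have hleft := congrArg (PowerSeries.map φ) (jConvergent_succ_mul N d l)
    have hright := jConvergent_succ_mul N (φ ∘ d) (φ ∘ l)
    simp only [map_mul, map_sub, map_one, map_pow, map_X, map_C, ih] at hleft
    exact left_inv_eq_right_inv ((mul_comm _ _).trans hleft) hright

theorem map_jFraction (d l : ℕ → R) :
    PowerSeries.map φ (jFraction d l) = jFraction (φ ∘ d) (φ ∘ l) := by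
  ext n
  rw [jFraction, jFraction, coeff_map, coeff_mk, coeff_mk, ← map_jConvergent, coeff_map]

theorem map_kFraction (d l : ℕ → R) :
    PowerSeries.map φ (kFraction d l) = kFraction (φ ∘ d) (φ ∘ l) := by
  simp only [kFraction, map_add, map_mul, map_pow, map_X, map_C, map_jFraction]
  rfl

end Map

/-- The generating function, by number of steps, of the Motzkin paths from height `0` to height `h`
in which an up step to height `k` weighs `d k` and a level step at height `k` weighs `l k`. The
recursion is the decomposition of a path at its last step from height `h` to height `h + 1`. -/
noncomputable def motzkinSeries (d l : ℕ → R) : ℕ → R⟦X⟧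
  | 0 => jFraction d l
  | h + 1 => C (d (h + 1)) * X * jFraction (fun k => d (k + (h + 1))) (fun k => l (k + (h + 1))) *
      motzkinSeries d l h

theorem one_sub_mul_jFraction_shift (d l : ℕ → R) (h : ℕ) :
    (1 - C (l h) * X - C (d (h + 1)) * X ^ 2 *
        jFraction (fun k => d (k + (h + 1))) fun k => l (k + (h + 1))) *
      jFraction (fun k => d (k + h)) (fun k => l (k + h)) = 1 := by
  have := one_sub_kFraction_mul_jFraction (fun k => d (k + h)) (fun k => l (k + h))
  simpa only [kFraction, sub_sub, zero_add, add_assoc, add_comm 1 h] using this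

theorem motzkinSeries_zero (d l : ℕ → R) :
    motzkinSeries d l 0 = 1 + X * (C (l 0) * motzkinSeries d l 0 + motzkinSeries d l 1) := by
  simp only [motzkinSeries]
  linear_combination one_sub_mul_jFraction_shift d l 0

theorem motzkinSeries_succ (d l : ℕ → R) (h : ℕ) :
    motzkinSeries d l (h + 1) = X * (C (d (h + 1)) * motzkinSeries d l h +
      C (l (h + 1)) * motzkinSeries d l (h + 1) + motzkinSeries d l (h + 2)) := by
  simp only [motzkinSeries]
  linear_combination
    C (d (h + 1)) * X * motzkinSeries d l h * one_sub_mul_jFraction_shift d l (h + 1)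

theorem coeff_motzkinSeries_eq_of_recurrence {B : ℕ → ℕ → R} {d l : ℕ → R}
    (hzero : B 0 0 = 1) (hzero_succ : ∀ h, B 0 (h + 1) = 0)
    (hsucc_zero : ∀ n, B (n + 1) 0 = l 0 * B n 0 + B n 1)
    (hsucc_succ : ∀ n h, B (n + 1) (h + 1) =
      d (h + 1) * B n h + l (h + 1) * B n (h + 1) + B n (h + 2)) (n h : ℕ) :
    coeff n (motzkinSeries d l h) = B n h := by
  induction n generalizing h with
  | zero =>
    cases h with
    | zero => rw [motzkinSeries_zero, hzero]; simp
    | succ h => rw [motzkinSeries_succ, hzero_succ]; simp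
  | succ n ih =>
    cases h with
    | zero => rw [motzkinSeries_zero, hsucc_zero]; simp [coeff_succ_X_mul, coeff_one, ih]
    | succ h => rw [motzkinSeries_succ, hsucc_succ]; simp [coeff_succ_X_mul, ih]

theorem coeff_one_coeff_of_one_sub_C_X_mul {A J : (Polynomial R)⟦X⟧}
    (h : (1 - C Polynomial.X * A) * J = 1) (n : ℕ) :
    (coeff n J).coeff 1 = coeff n (PowerSeries.map Polynomial.constantCoeff A) := by
  have hJ : J = 1 + C Polynomial.X * (A * J) := by linear_combination h
  have hmap : PowerSeries.map Polynomial.constantCoeff J = 1 := by rw [hJ]; simp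
  have hone : (coeff n (1 : (Polynomial R)⟦X⟧)).coeff 1 = 0 := by
    rw [coeff_one]
    split_ifs <;> simp [Polynomial.coeff_one]
  calc (coeff n J).coeff 1 = (coeff n (A * J)).coeff 0 := by
        rw [hJ, map_add, coeff_C_mul, Polynomial.coeff_add, hone, zero_add,
          Polynomial.coeff_X_mul, ← hJ]
    _ = coeff n (PowerSeries.map Polynomial.constantCoeff (A * J)) := by rw [coeff_map]; rfl
    _ = coeff n (PowerSeries.map Polynomial.constantCoeff A) := by rw [map_mul, hmap, mul_one]

end Fractions

section Subsets

variable {A : Type*} [AddCommMonoid A]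

theorem sum_powersetCard_sum_insert_of_forall_lt {α : Type*} [LinearOrder α] (s : Finset α) (h : ℕ)
    (f : Finset α → A) :
    ∑ M ∈ s.powersetCard h, ∑ j ∈ s with ∀ k ∈ M, j < k, f (insert j M) =
      ∑ M ∈ s.powersetCard (h + 1), f M := by
  have hmin {M : Finset α} {j : α} (hj : ∀ k ∈ M, j < k) :
      (insert j M).min' (M.insert_nonempty j) = j := by
    refine (Finset.min'_eq_iff _ _ _).mpr ⟨M.mem_insert_self j, ?_⟩
    simpa using fun k hk => (hj k hk).le
  have hne {S : Finset α} (hS : S ∈ s.powersetCard (h + 1)) : S.Nonempty :=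
    Finset.card_pos.mp ((Finset.mem_powersetCard.mp hS).2 ▸ h.succ_pos)
  rw [Finset.sum_sigma']
  refine Finset.sum_bij' (fun p _ => insert p.2 p.1)
    (fun S hS => ⟨S.erase (S.min' (hne hS)), S.min' (hne hS)⟩) ?_ ?_ ?_ ?_ fun _ _ => rfl
  · rintro ⟨M, j⟩ hMj
    simp only [Finset.mem_sigma, Finset.mem_filter, Finset.mem_powersetCard] at hMj ⊢
    obtain ⟨⟨hMs, hM⟩, hjs, hj⟩ := hMj
    refine ⟨Finset.insert_subset hjs hMs, ?_⟩
    rw [Finset.card_insert_of_notMem fun hjM => (hj j hjM).false, hM]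
  · intro S hS
    obtain ⟨hSs, hcard⟩ := Finset.mem_powersetCard.mp hS
    simp only [Finset.mem_sigma, Finset.mem_filter, Finset.mem_powersetCard]
    refine ⟨⟨(Finset.erase_subset _ S).trans hSs, ?_⟩, hSs (S.min'_mem _), fun k hk =>
      S.min'_lt_of_mem_erase_min' (hne hS) hk⟩
    rw [Finset.card_erase_of_mem (S.min'_mem _), hcard, Nat.add_sub_cancel]
  · rintro ⟨M, j⟩ hMj
    simp only [Finset.mem_sigma, Finset.mem_filter] at hMj
    have hj := hMj.2.2
    simp only [hmin hj, Finset.erase_insert fun hjM => (hj j hjM).false]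
  · exact fun S hS => Finset.insert_erase (S.min'_mem (hne hS))

theorem sum_powersetCard_insert {α : Type*} [DecidableEq α] {a : α} {s : Finset α} (ha : a ∉ s)
    (h : ℕ) (f : Finset α → A) :
    ∑ M ∈ (insert a s).powersetCard (h + 1), f M =
      ∑ M ∈ s.powersetCard (h + 1), f M + ∑ M ∈ s.powersetCard h, f (insert a M) := by
  have notMem {m : ℕ} {M : Finset α} (hM : M ∈ s.powersetCard m) : a ∉ M :=
    Finset.notMem_mono (Finset.mem_powersetCard.mp hM).1 ha
  rw [Finset.powersetCard_succ_insert ha, Finset.sum_union, Finset.sum_image]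
  · intro M hM N hN hMN
    rw [← Finset.erase_insert (notMem hM), ← Finset.erase_insert (notMem hN), hMN]
  · rw [Finset.disjoint_right]
    simp only [Finset.mem_image]
    rintro _ ⟨M, -, rfl⟩ hM
    exact notMem hM (M.mem_insert_self a)

theorem sum_powersetCard_univ_fin_succ {n : ℕ} (h : ℕ) (f : Finset (Fin (n + 1)) → A) :
    ∑ M ∈ (Finset.univ : Finset (Fin (n + 1))).powersetCard (h + 1), f M =
      ∑ M ∈ (Finset.univ : Finset (Fin n)).powersetCard (h + 1), f (M.map Fin.castSuccEmb) +
      ∑ M ∈ (Finset.univ : Finset (Fin n)).powersetCard h,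
        f (insert (Fin.last n) (M.map Fin.castSuccEmb)) := by
  rw [Fin.univ_castSuccEmb, Finset.cons_eq_insert, sum_powersetCard_insert (by simp)]
  simp only [Finset.powersetCard_map, Finset.sum_map]
  rfl

end Subsets

section Insertion

variable {n : ℕ}

/-- The extension of a permutation of `Fin n` by the fixed point `Fin.last n`. -/
def extendLast (σ : Equiv.Perm (Fin n)) : Equiv.Perm (Fin (n + 1)) :=
  finSuccEquivLast.symm.permCongr (Equiv.Perm.decomposeOption.symm (none, σ))

/-- The permutation obtained by inserting `Fin.last n` into the cycle of `j`, directly after `j`. -/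
def insertAfter (σ : Equiv.Perm (Fin n)) (j : Fin n) : Equiv.Perm (Fin (n + 1)) :=
  finSuccEquivLast.symm.permCongr (Equiv.Perm.decomposeOption.symm (some (σ j), σ))

@[simp] theorem extendLast_last (σ : Equiv.Perm (Fin n)) :
    extendLast σ (Fin.last n) = Fin.last n := by
  simp [extendLast, Equiv.permCongr_apply]

@[simp] theorem extendLast_castSucc (σ : Equiv.Perm (Fin n)) (i : Fin n) :
    extendLast σ i.castSucc = (σ i).castSucc := by
  simp [extendLast, Equiv.permCongr_apply]

@[simp] theorem insertAfter_last (σ : Equiv.Perm (Fin n)) (j : Fin n) :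
    insertAfter σ j (Fin.last n) = (σ j).castSucc := by
  simp [insertAfter, Equiv.permCongr_apply]

@[simp] theorem insertAfter_castSucc_self (σ : Equiv.Perm (Fin n)) (j : Fin n) :
    insertAfter σ j j.castSucc = Fin.last n := by
  simp [insertAfter, Equiv.permCongr_apply]

theorem insertAfter_castSucc_of_ne (σ : Equiv.Perm (Fin n)) {i j : Fin n} (hij : i ≠ j) :
    insertAfter σ j i.castSucc = (σ i).castSucc := by
  simp [insertAfter, Equiv.permCongr_apply, Equiv.swap_apply_of_ne_of_ne, hij]

theorem sum_perm_fin_succ {A : Type*} [AddCommMonoid A] (f : Equiv.Perm (Fin (n + 1)) → A) :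
    ∑ π, f π = ∑ σ : Equiv.Perm (Fin n), (f (extendLast σ) + ∑ j, f (insertAfter σ j)) := by
  rw [← finSuccEquivLast.symm.permCongr.sum_comp, ← Equiv.Perm.decomposeOption.symm.sum_comp,
    Fintype.sum_prod_type_right]
  refine Finset.sum_congr rfl fun σ _ => ?_
  rw [Fintype.sum_option, ← Equiv.sum_comp σ]
  rfl

end Insertion

section Cycles

theorem sameCycle_map {α β : Type*} {σ : Equiv.Perm α} {τ : Equiv.Perm β} (f : α → β)
    (hf : ∀ a, τ.SameCycle (f a) (f (σ a))) {a b : α} (h : σ.SameCycle a b) :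
    τ.SameCycle (f a) (f b) := by
  obtain ⟨k, rfl⟩ := h
  induction k with
  | zero => exact Equiv.Perm.SameCycle.refl τ (f a)
  | succ k ih =>
    rw [add_comm, zpow_one_add]
    exact ih.trans (hf _)
  | pred k ih =>
    have hback := hf ((σ ^ (-(k : ℤ) - 1)) a)
    rw [← Equiv.Perm.mul_apply, ← zpow_one_add, add_sub_cancel] at hback
    exact ih.trans hback.symm

theorem sameCycle_iff_of_leftInverse {α β : Type*} {σ : Equiv.Perm α} {τ : Equiv.Perm β}
    {f : α → β} {g : β → α} (hgf : Function.LeftInverse g f)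
    (hf : ∀ a, τ.SameCycle (f a) (f (σ a))) (hg : ∀ b, σ.SameCycle (g b) (g (τ b))) {a b : α} :
    τ.SameCycle (f a) (f b) ↔ σ.SameCycle a b :=
  ⟨fun h => by simpa only [hgf _] using sameCycle_map g hg h, sameCycle_map f hf⟩

variable {n : ℕ} (σ : Equiv.Perm (Fin n)) (j : Fin n)

theorem extendLast_sameCycle_castSucc {i k : Fin n} :
    (extendLast σ).SameCycle i.castSucc k.castSucc ↔ σ.SameCycle i k := by
  refine sameCycle_iff_of_leftInverse (g := Fin.lastCases i id) (fun _ => by simp)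
    (fun a => ?_) fun b => ?_
  · rw [← extendLast_castSucc]
    exact Equiv.Perm.SameCycle.rfl.apply_right
  · induction b using Fin.lastCases <;> simp [Equiv.Perm.SameCycle.rfl]

theorem insertAfter_sameCycle_last : (insertAfter σ j).SameCycle j.castSucc (Fin.last n) := by
  rw [← insertAfter_castSucc_self σ j]
  exact Equiv.Perm.SameCycle.rfl.apply_right

theorem insertAfter_sameCycle_castSucc {i k : Fin n} :
    (insertAfter σ j).SameCycle i.castSucc k.castSucc ↔ σ.SameCycle i k := by
  refine sameCycle_iff_of_leftInverse (g := Fin.lastCases j id) (fun _ => by simp)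
    (fun a => ?_) fun b => ?_
  · by_cases ha : a = j
    · subst ha
      rw [← insertAfter_last]
      exact (insertAfter_sameCycle_last σ a).apply_right
    · rw [← insertAfter_castSucc_of_ne σ ha]
      exact Equiv.Perm.SameCycle.rfl.apply_right
  · induction b using Fin.lastCases with
    | last => simp [Equiv.Perm.SameCycle.rfl]
    | cast b =>
      by_cases hb : b = j
      · simp [hb, Equiv.Perm.SameCycle.rfl]
      · simp [insertAfter_castSucc_of_ne σ hb, Equiv.Perm.SameCycle.rfl]

theorem cyc_extendLast : cyc (extendLast σ) = cyc σ + 1 := by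
  let toQuotient : Option (Quotient (Equiv.Perm.SameCycle.setoid σ)) →
      Quotient (Equiv.Perm.SameCycle.setoid (extendLast σ)) :=
    fun o => o.elim ⟦Fin.last n⟧
      (Quotient.map Fin.castSucc fun _ _ => (extendLast_sameCycle_castSucc σ).mpr)
  have hlast (i : Fin n) : ¬ (extendLast σ).SameCycle (Fin.last n) i.castSucc := fun h =>
    i.castSucc_ne_last (h.eq_of_left (extendLast_last σ)).symm
  have hbij : Function.Bijective toQuotient := by
    constructor
    · rintro (_ | ⟨⟨i⟩⟩) (_ | ⟨⟨k⟩⟩) h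
      · rfl
      · exact absurd (Quotient.exact h) (hlast k)
      · exact absurd (Quotient.exact h.symm) (hlast i)
      · exact congrArg some
          (Quotient.sound ((extendLast_sameCycle_castSucc σ).mp (Quotient.exact h)))
    · rintro ⟨a⟩
      induction a using Fin.lastCases with
      | last => exact ⟨none, rfl⟩
      | cast i => exact ⟨some ⟦i⟧, rfl⟩
  rw [cyc, cyc, ← Nat.card_eq_of_bijective toQuotient hbij, Finite.card_option]

theorem cyc_insertAfter : cyc (insertAfter σ j) = cyc σ := by
  refine (Nat.card_eq_of_bijective
    (Quotient.map Fin.castSucc fun _ _ => (insertAfter_sameCycle_castSucc σ j).mpr) ⟨?_, ?_⟩).symm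
  · rintro ⟨i⟩ ⟨k⟩ h
    exact Quotient.sound ((insertAfter_sameCycle_castSucc σ j).mp (Quotient.exact h))
  · rintro ⟨a⟩
    induction a using Fin.lastCases with
    | last => exact ⟨⟦j⟧, Quotient.sound (insertAfter_sameCycle_last σ j)⟩
    | cast i => exact ⟨⟦i⟧, rfl⟩

theorem cyc_eq_zero (π : Equiv.Perm (Fin 0)) : cyc π = 0 :=
  have : IsEmpty (Quotient (Equiv.Perm.SameCycle.setoid π)) := ⟨Quotient.ind fun i => i.elim0⟩
  Nat.card_of_isEmpty

end Cycles

section Marked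

variable {n : ℕ}

/-- The excedance positions of `σ` outside the set `M` of marked positions. -/
def unmarkedExc (σ : Equiv.Perm (Fin n)) (M : Finset (Fin n)) : Set (Fin n) :=
  {i | i ∉ M ∧ i < σ i}

/-- Increasing excedances for a permutation with a set `M` of marked positions. A marked position is
one after which a larger element will be inserted later, so it counts as an excedance whose value
exceeds all present values; hence no unmarked excedance may stand to its right. -/
def MarkedIncreasing (σ : Equiv.Perm (Fin n)) (M : Finset (Fin n)) : Prop :=
  StrictMonoOn σ (unmarkedExc σ M) ∧ ∀ i ∈ unmarkedExc σ M, ∀ k ∈ M, i < k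

theorem markedIncreasing_empty {π : Equiv.Perm (Fin n)} :
    MarkedIncreasing π ∅ ↔ IncreasingExcedances π := by
  simp only [MarkedIncreasing, IncreasingExcedances, StrictMonoOn, unmarkedExc, Finset.notMem_empty,
    not_false_eq_true, true_and, Set.mem_ofPred_eq, false_implies, implies_true, and_true]
  exact ⟨fun H i j hij hi hj => H hi hj hij, fun H i hi j hj hij => H i j hij hi hj⟩

variable (σ : Equiv.Perm (Fin n)) {M : Finset (Fin n)} {M' : Finset (Fin (n + 1))} {j : Fin n}

theorem forall_castSucc_image_lt_iff (hM : ∀ i : Fin n, i.castSucc ∈ M' ↔ i ∈ M) {s : Set (Fin n)} :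
    (∀ i ∈ Fin.castSucc '' s, ∀ k ∈ M', i < k) ↔ ∀ i ∈ s, ∀ k ∈ M, i < k := by
  simp only [Set.forall_mem_image, Fin.forall_fin_succ', hM, Fin.castSucc_lt_castSucc_iff,
    Fin.castSucc_lt_last, implies_true, and_true]

theorem strictMonoOn_castSucc_image_iff {τ : Equiv.Perm (Fin (n + 1))} {s : Set (Fin n)}
    (h : ∀ i ∈ s, τ i.castSucc = (σ i).castSucc) :
    StrictMonoOn τ (Fin.castSucc '' s) ↔ StrictMonoOn σ s := by
  simp +contextual only [StrictMonoOn, Set.forall_mem_image, h, Fin.castSucc_lt_castSucc_iff]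

theorem unmarkedExc_extendLast (hM : ∀ i : Fin n, i.castSucc ∈ M' ↔ i ∈ M) :
    unmarkedExc (extendLast σ) M' = Fin.castSucc '' unmarkedExc σ M := by
  ext a
  induction a using Fin.lastCases <;> simp [unmarkedExc, hM, Fin.castSucc_ne_last]

theorem unmarkedExc_insertAfter_of_mem (hM : ∀ i : Fin n, i.castSucc ∈ M' ↔ i ∈ M) (hj : j ∈ M) :
    unmarkedExc (insertAfter σ j) M' = Fin.castSucc '' unmarkedExc σ M := by
  ext a
  induction a using Fin.lastCases with
  | last => simp [unmarkedExc, Fin.castSucc_ne_last, Fin.le_last]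
  | cast i =>
    by_cases hi : i = j
    · simp [unmarkedExc, hM, hi, hj]
    · simp [unmarkedExc, hM, insertAfter_castSucc_of_ne σ hi]

theorem unmarkedExc_insertAfter_of_notMem (hM : ∀ i : Fin n, i.castSucc ∈ M' ↔ i ∈ M)
    (hj : j ∉ M) :
    unmarkedExc (insertAfter σ j) M' =
      insert j.castSucc (Fin.castSucc '' unmarkedExc σ (insert j M)) := by
  ext a
  induction a using Fin.lastCases with
  | last => simp [unmarkedExc, Fin.castSucc_ne_last, (Fin.castSucc_ne_last _).symm, Fin.le_last]
  | cast i =>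
    by_cases hi : i = j
    · simp [unmarkedExc, hM, hi, hj, Fin.castSucc_lt_last]
    · simp [unmarkedExc, hM, hi, insertAfter_castSucc_of_ne σ hi]

theorem markedIncreasing_extendLast (hM : ∀ i : Fin n, i.castSucc ∈ M' ↔ i ∈ M) :
    MarkedIncreasing (extendLast σ) M' ↔ MarkedIncreasing σ M := by
  rw [MarkedIncreasing, unmarkedExc_extendLast σ hM, forall_castSucc_image_lt_iff hM,
    strictMonoOn_castSucc_image_iff σ fun i _ => extendLast_castSucc σ i, MarkedIncreasing]

theorem markedIncreasing_insertAfter_of_mem (hM : ∀ i : Fin n, i.castSucc ∈ M' ↔ i ∈ M)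
    (hj : j ∈ M) : MarkedIncreasing (insertAfter σ j) M' ↔ MarkedIncreasing σ M := by
  have hne : ∀ i ∈ unmarkedExc σ M, i ≠ j := fun i hi hij => hi.1 (hij ▸ hj)
  rw [MarkedIncreasing, unmarkedExc_insertAfter_of_mem σ hM hj, forall_castSucc_image_lt_iff hM,
    strictMonoOn_castSucc_image_iff σ fun i hi => insertAfter_castSucc_of_ne σ (hne i hi),
    MarkedIncreasing]

theorem markedIncreasing_insertAfter_of_notMem (hM : ∀ i : Fin n, i.castSucc ∈ M' ↔ i ∈ M)
    (hj : j ∉ M) :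
    MarkedIncreasing (insertAfter σ j) M' ↔
      (∀ k ∈ M, j < k) ∧ MarkedIncreasing σ (insert j M) := by
  set s := unmarkedExc σ (insert j M)
  have hne : ∀ i ∈ s, i ≠ j := fun i hi hij => hi.1 (hij ▸ Finset.mem_insert_self j M)
  have hins : ∀ i ∈ s, insertAfter σ j i.castSucc = (σ i).castSucc :=
    fun i hi => insertAfter_castSucc_of_ne σ (hne i hi)
  have hjM : (∀ k ∈ M', j.castSucc < k) ↔ ∀ k ∈ M, j < k := by
    simpa using forall_castSucc_image_lt_iff hM (s := {j})
  have hmono : StrictMonoOn (insertAfter σ j) (insert j.castSucc (Fin.castSucc '' s)) ↔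
      (∀ i ∈ s, i < j) ∧ StrictMonoOn σ s := by
    have habove : (∀ i ∈ s, ¬ j < i) ↔ ∀ i ∈ s, i < j :=
      forall₂_congr fun i hi => ⟨fun h => (not_lt.mp h).lt_of_ne (hne i hi), fun h => h.not_gt⟩
    rw [strictMonoOn_insert_iff, strictMonoOn_castSucc_image_iff σ hins]
    simp +contextual only [Set.forall_mem_image, Fin.castSucc_lt_castSucc_iff, hins,
      insertAfter_castSucc_self, Fin.castSucc_lt_last, implies_true, true_and,
      (Fin.castSucc_lt_last _).not_gt, imp_false, habove]
  rw [MarkedIncreasing, unmarkedExc_insertAfter_of_notMem σ hM hj, hmono, Set.forall_mem_insert,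
    forall_castSucc_image_lt_iff hM, hjM, MarkedIncreasing]
  simp only [Finset.forall_mem_insert, forall_and]
  tauto

end Marked

section Weights

variable {R : Type*} [CommSemiring R] (x v w t : R) {n : ℕ}

/-- The contribution of the position `i` to the weight of a permutation with marked positions `M`:
`v` for an excedance, times `w` if it is a double excedance, and `x` for a fixed point. Marked
positions count as excedances, but whether they are double excedances is left open. -/
def posWeight (σ : Equiv.Perm (Fin n)) (M : Finset (Fin n)) (i : Fin n) : R :=
  if i ∈ M then v
  else if σ i = i then x
  else if i < σ i then (if σ i ∈ M ∨ σ i < σ (σ i) then v * w else v)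
  else 1

open Classical in
/-- The weight of a permutation with marked positions `M`, set to `0` unless the excedances are
increasing. -/
noncomputable def markedWeight (σ : Equiv.Perm (Fin n)) (M : Finset (Fin n)) : R :=
  if MarkedIncreasing σ M then (∏ i, posWeight x v w σ M i) * t ^ cyc σ else 0

/-- The total weight of the permutations of `Fin n` with `h` marked positions. -/
noncomputable def markedSum (n h : ℕ) : R :=
  ∑ M ∈ (Finset.univ : Finset (Fin n)).powersetCard h,
    ∑ σ : Equiv.Perm (Fin n), markedWeight x v w t σ M

theorem prod_posWeight_empty (π : Equiv.Perm (Fin n)) :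
    ∏ i, posWeight x v w π ∅ i = x ^ fp π * v ^ exc π * w ^ dexc π := by
  simp only [fp, exc, dexc, Finset.card_filter, ← Finset.prod_pow_eq_pow_sum,
    ← Finset.prod_mul_distrib]
  refine Finset.prod_congr rfl fun i _ => ?_
  rcases lt_trichotomy i (π i) with hexc | hfix | hdef
  · by_cases hdexc : π i < π (π i) <;> simp [posWeight, hexc, hexc.ne', hdexc]
  · simp [posWeight, ← hfix]
  · simp [posWeight, hdef.ne, hdef.not_gt]

theorem markedSum_zero_right (n : ℕ) :
    markedSum x v w t n 0 = ∑ π ∈ IE n, x ^ fp π * v ^ exc π * w ^ dexc π * t ^ cyc π := by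
  simp only [markedSum, Finset.powersetCard_zero, Finset.sum_singleton, markedWeight,
    prod_posWeight_empty, IE, Finset.sum_filter]
  classical exact Finset.sum_congr rfl fun π _ => if_congr markedIncreasing_empty rfl rfl

theorem markedSum_zero_zero : markedSum x v w t 0 0 = 1 := by
  have hinc : ∀ π : Equiv.Perm (Fin 0), MarkedIncreasing π ∅ := fun π =>
    markedIncreasing_empty.mpr fun i => i.elim0
  simp [markedSum, markedWeight, hinc, cyc_eq_zero]

theorem markedSum_eq_zero_of_lt {n h : ℕ} (hnh : n < h) : markedSum x v w t n h = 0 := by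
  rw [markedSum, Finset.powersetCard_eq_empty.mpr (by simpa using hnh), Finset.sum_empty]

theorem markedSum_succ_right (n h : ℕ) :
    markedSum x v w t n (h + 1) =
      ∑ M ∈ (Finset.univ : Finset (Fin n)).powersetCard h, ∑ j with ∀ k ∈ M, j < k,
        ∑ σ, markedWeight x v w t σ (insert j M) := by
  rw [markedSum, ← sum_powersetCard_sum_insert_of_forall_lt]
  congr!

theorem markedWeight_eq_mul {m : ℕ} {τ : Equiv.Perm (Fin m)} {N : Finset (Fin m)}
    {σ : Equiv.Perm (Fin n)} {M : Finset (Fin n)} (c : R)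
    (hinc : MarkedIncreasing τ N ↔ MarkedIncreasing σ M)
    (hweight : (∏ i, posWeight x v w τ N i) * t ^ cyc τ =
      c * ((∏ i, posWeight x v w σ M i) * t ^ cyc σ)) :
    markedWeight x v w t τ N = c * markedWeight x v w t σ M := by
  by_cases hM : MarkedIncreasing σ M
  · rw [markedWeight, markedWeight, if_pos hM, if_pos (hinc.mpr hM), hweight]
  · rw [markedWeight, markedWeight, if_neg hM, if_neg (mt hinc.mp hM), mul_zero]

section Insert

variable (σ : Equiv.Perm (Fin n)) {M : Finset (Fin n)} {M' : Finset (Fin (n + 1))} {j : Fin n}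

theorem markedWeight_extendLast (hM : ∀ i : Fin n, i.castSucc ∈ M' ↔ i ∈ M) :
    markedWeight x v w t (extendLast σ) M' =
      (if Fin.last n ∈ M' then v else x) * t * markedWeight x v w t σ M := by
  refine markedWeight_eq_mul x v w t _ (markedIncreasing_extendLast σ hM) ?_
  simp only [Fin.prod_univ_castSucc, posWeight, hM, extendLast_castSucc, extendLast_last,
    Fin.castSucc_inj, Fin.castSucc_lt_castSucc_iff, if_true, cyc_extendLast]
  ring

theorem posWeight_insertAfter_last :
    posWeight x v w (insertAfter σ j) M' (Fin.last n) = if Fin.last n ∈ M' then v else 1 := by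
  simp [posWeight, Fin.castSucc_ne_last, (Fin.castSucc_lt_last _).not_gt]

theorem posWeight_insertAfter_castSucc_of_mem (hM : ∀ i : Fin n, i.castSucc ∈ M' ↔ i ∈ M)
    (hj : j ∈ M) (i : Fin n) :
    posWeight x v w (insertAfter σ j) M' i.castSucc = posWeight x v w σ M i := by
  by_cases hi : i ∈ M
  · simp [posWeight, hM, hi]
  · have hij : i ≠ j := fun h => hi (h ▸ hj)
    by_cases hσi : σ i = j
    · simp [posWeight, hM, hi, insertAfter_castSucc_of_ne σ hij, hσi, hj]
    · simp [posWeight, hM, hi, insertAfter_castSucc_of_ne σ hij, insertAfter_castSucc_of_ne σ hσi]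

theorem markedWeight_insertAfter_of_mem (hM : ∀ i : Fin n, i.castSucc ∈ M' ↔ i ∈ M) (hj : j ∈ M) :
    markedWeight x v w t (insertAfter σ j) M' =
      (if Fin.last n ∈ M' then v else 1) * markedWeight x v w t σ M := by
  refine markedWeight_eq_mul x v w t _ (markedIncreasing_insertAfter_of_mem σ hM hj) ?_
  simp only [Fin.prod_univ_castSucc, posWeight_insertAfter_last, cyc_insertAfter,
    posWeight_insertAfter_castSucc_of_mem x v w σ hM hj]
  ring

theorem posWeight_insertAfter_castSucc_self (hM : ∀ i : Fin n, i.castSucc ∈ M' ↔ i ∈ M)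
    (hj : j ∉ M) :
    posWeight x v w (insertAfter σ j) M' j.castSucc =
      if Fin.last n ∈ M' then v * w else v := by
  simp [posWeight, hM, hj, Fin.castSucc_lt_last, (Fin.castSucc_ne_last _).symm,
    (Fin.castSucc_lt_last _).not_gt]

theorem posWeight_insertAfter_castSucc_of_ne (hM : ∀ i : Fin n, i.castSucc ∈ M' ↔ i ∈ M)
    {i : Fin n} (hij : i ≠ j) :
    posWeight x v w (insertAfter σ j) M' i.castSucc = posWeight x v w σ (insert j M) i := by
  by_cases hσi : σ i = j
  · simp [posWeight, hM, hij, insertAfter_castSucc_of_ne σ hij, hσi, Fin.castSucc_lt_last]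
  · simp [posWeight, hM, hij, insertAfter_castSucc_of_ne σ hij, insertAfter_castSucc_of_ne σ hσi,
      hσi]

theorem prod_posWeight_insertAfter_of_notMem (hM : ∀ i : Fin n, i.castSucc ∈ M' ↔ i ∈ M)
    (hj : j ∉ M) :
    ∏ i, posWeight x v w (insertAfter σ j) M' i =
      (if Fin.last n ∈ M' then v * w else 1) * ∏ i, posWeight x v w σ (insert j M) i := by
  have hself : posWeight x v w σ (insert j M) j = v := by simp [posWeight]
  have hrest : ∏ i ∈ Finset.univ.erase j, posWeight x v w (insertAfter σ j) M' i.castSucc =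
      ∏ i ∈ Finset.univ.erase j, posWeight x v w σ (insert j M) i :=
    Finset.prod_congr rfl fun i hi =>
      posWeight_insertAfter_castSucc_of_ne x v w σ hM (Finset.ne_of_mem_erase hi)
  rw [Fin.prod_univ_castSucc, ← Finset.mul_prod_erase Finset.univ _ (Finset.mem_univ j), hrest,
    ← Finset.mul_prod_erase Finset.univ (posWeight x v w σ (insert j M)) (Finset.mem_univ j),
    hself, posWeight_insertAfter_castSucc_self x v w σ hM hj, posWeight_insertAfter_last]
  split_ifs <;> ring

theorem markedWeight_insertAfter_of_notMem (hM : ∀ i : Fin n, i.castSucc ∈ M' ↔ i ∈ M)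
    (hj : j ∉ M) :
    markedWeight x v w t (insertAfter σ j) M' =
      (if Fin.last n ∈ M' then v * w else 1) *
        if ∀ k ∈ M, j < k then markedWeight x v w t σ (insert j M) else 0 := by
  have hinc := markedIncreasing_insertAfter_of_notMem σ hM hj
  by_cases hmin : ∀ k ∈ M, j < k
  · rw [if_pos hmin]
    refine markedWeight_eq_mul x v w t _ (hinc.trans (and_iff_right hmin)) ?_
    rw [prod_posWeight_insertAfter_of_notMem x v w σ hM hj, cyc_insertAfter, mul_assoc]
  · rw [if_neg hmin, mul_zero, markedWeight, if_neg fun h => hmin (hinc.mp h).1]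

theorem sum_markedWeight_insertAfter (hM : ∀ i : Fin n, i.castSucc ∈ M' ↔ i ∈ M) :
    ∑ j, markedWeight x v w t (insertAfter σ j) M' =
      (if Fin.last n ∈ M' then v else 1) * M.card * markedWeight x v w t σ M +
      (if Fin.last n ∈ M' then v * w else 1) *
        ∑ j with ∀ k ∈ M, j < k, markedWeight x v w t σ (insert j M) := by
  have hmarked : ∑ j with j ∈ M, markedWeight x v w t (insertAfter σ j) M' =
      (if Fin.last n ∈ M' then v else 1) * M.card * markedWeight x v w t σ M := by
    rw [Finset.sum_congr rfl fun j hj => markedWeight_insertAfter_of_mem x v w t σ hM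
      (Finset.mem_filter.mp hj).2]
    simp only [Finset.filter_univ_mem, Finset.sum_const, nsmul_eq_mul]
    ring
  have hunmarked : ∑ j with j ∉ M, markedWeight x v w t (insertAfter σ j) M' =
      (if Fin.last n ∈ M' then v * w else 1) *
        ∑ j with ∀ k ∈ M, j < k, markedWeight x v w t σ (insert j M) := by
    rw [Finset.sum_congr rfl fun j hj => markedWeight_insertAfter_of_notMem x v w t σ hM
      (Finset.mem_filter.mp hj).2, ← Finset.mul_sum, ← Finset.sum_filter, Finset.filter_filter]
    congr 2
    ext j
    simpa using fun hj hjM => (hj j hjM).false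
  rw [← Finset.sum_filter_add_sum_filter_not Finset.univ (· ∈ M), hmarked, hunmarked]

end Insert

theorem sum_perm_markedWeight_succ {M : Finset (Fin n)} {M' : Finset (Fin (n + 1))}
    (hM : ∀ i : Fin n, i.castSucc ∈ M' ↔ i ∈ M) :
    ∑ π, markedWeight x v w t π M' =
      ((if Fin.last n ∈ M' then v else x) * t + (if Fin.last n ∈ M' then v else 1) * M.card) *
        ∑ σ, markedWeight x v w t σ M +
      (if Fin.last n ∈ M' then v * w else 1) *
        ∑ j with ∀ k ∈ M, j < k, ∑ σ, markedWeight x v w t σ (insert j M) := by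
  rw [sum_perm_fin_succ, Finset.sum_comm (s := Finset.filter _ _)]
  simp only [markedWeight_extendLast x v w t _ hM, sum_markedWeight_insertAfter x v w t _ hM,
    Finset.sum_add_distrib, ← Finset.mul_sum]
  ring

theorem sum_markedWeight_map_castSucc (n h : ℕ) :
    ∑ M ∈ (Finset.univ : Finset (Fin n)).powersetCard h,
        ∑ π, markedWeight x v w t π (M.map Fin.castSuccEmb) =
      (x * t + h) * markedSum x v w t n h + markedSum x v w t n (h + 1) := by
  rw [markedSum_succ_right, markedSum, Finset.mul_sum, ← Finset.sum_add_distrib]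
  refine Finset.sum_congr rfl fun M hM => ?_
  rw [sum_perm_markedWeight_succ (M := M) _ _ _ _ (by simp), (Finset.mem_powersetCard.mp hM).2]
  simp [Fin.castSucc_ne_last]

theorem sum_markedWeight_insert_last (n h : ℕ) :
    ∑ M ∈ (Finset.univ : Finset (Fin n)).powersetCard h,
        ∑ π, markedWeight x v w t π (insert (Fin.last n) (M.map Fin.castSuccEmb)) =
      v * (h + t) * markedSum x v w t n h + v * w * markedSum x v w t n (h + 1) := by
  rw [markedSum_succ_right, markedSum, Finset.mul_sum, Finset.mul_sum, ← Finset.sum_add_distrib]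
  refine Finset.sum_congr rfl fun M hM => ?_
  rw [sum_perm_markedWeight_succ (M := M) _ _ _ _ (by simp [Fin.castSucc_ne_last]),
    (Finset.mem_powersetCard.mp hM).2]
  simp only [Finset.mem_insert_self, if_true]
  ring

theorem markedSum_succ_zero (n : ℕ) :
    markedSum x v w t (n + 1) 0 = x * t * markedSum x v w t n 0 + markedSum x v w t n 1 := by
  simpa [markedSum] using sum_markedWeight_map_castSucc x v w t n 0

theorem markedSum_succ_succ (n h : ℕ) :
    markedSum x v w t (n + 1) (h + 1) = v * (h + t) * markedSum x v w t n h +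
      (x * t + v * w + (h + 1)) * markedSum x v w t n (h + 1) + markedSum x v w t n (h + 2) := by
  rw [markedSum, sum_powersetCard_univ_fin_succ, sum_markedWeight_map_castSucc,
    sum_markedWeight_insert_last]
  push_cast
  ring

end Weights

section GeneratingFunctions

variable {R : Type*} [CommRing R] (x v w t : R)

theorem mk_sum_IE_eq_jFraction :
    PowerSeries.mk (fun n => ∑ π ∈ IE n, x ^ fp π * v ^ exc π * w ^ dexc π * t ^ cyc π) =
      jFraction (fun h => v * ((h : R) - 1 + t))
        (fun h => if h = 0 then x * t else x * t + v * w + (h : R)) := by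
  ext n
  rw [coeff_mk, ← markedSum_zero_right, ← motzkinSeries]
  refine (coeff_motzkinSeries_eq_of_recurrence (markedSum_zero_zero x v w t)
    (fun h => markedSum_eq_zero_of_lt x v w t h.succ_pos) (fun n => ?_) (fun n h => ?_) n 0).symm
  · simp [markedSum_succ_zero]
  · simp [markedSum_succ_succ]

theorem cyc_eq_one_of_mem_CIE {n : ℕ} {π : Equiv.Perm (Fin n)} (hπ : π ∈ CIE n) : cyc π = 1 := by
  classical exact (Finset.mem_filter.mp hπ).2.1

theorem coeff_one_sum_IE (n : ℕ) :
    (∑ π ∈ IE n, Polynomial.C x ^ fp π * Polynomial.C v ^ exc π * Polynomial.C w ^ dexc π *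
        Polynomial.X ^ cyc π).coeff 1 =
      ∑ π ∈ CIE n, x ^ fp π * v ^ exc π * w ^ dexc π := by
  have hCIE : CIE n = (IE n).filter fun π => 1 = cyc π := by
    classical
    ext π
    simp [CIE, IE, IsCyclic, and_comm, @eq_comm _ 1]
  simp only [hCIE, Finset.sum_filter, Polynomial.finsetSum_coeff, ← Polynomial.C_pow,
    ← Polynomial.C_mul, Polynomial.coeff_C_mul, Polynomial.coeff_X_pow, mul_ite, mul_one, mul_zero]

theorem mk_sum_CIE_eq_kFraction :
    PowerSeries.mk (fun n => ∑ π ∈ CIE n, x ^ fp π * v ^ exc π * w ^ dexc π) =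
      kFraction (fun h => if h = 1 then v else ((h : R) - 1) * v)
        (fun h => if h = 0 then x else v * w + (h : R)) := by
  let T : Polynomial R := Polynomial.X
  let d : ℕ → Polynomial R := fun h => Polynomial.C v * ((h : Polynomial R) - 1 + T)
  let l : ℕ → Polynomial R := fun h => if h = 0 then Polynomial.C x * T
    else Polynomial.C x * T + Polynomial.C v * Polynomial.C w + (h : Polynomial R)
  let d' : ℕ → Polynomial R := fun h => if h = 1 then Polynomial.C v else d h
  let l' : ℕ → Polynomial R := fun h => if h = 0 then Polynomial.C x else l h
  have hK : kFraction d l = C T * kFraction d' l' :=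
    kFraction_eq_C_mul T (by simp [l, l', mul_comm]) (by simp [d, d', mul_comm])
      (fun h => by simp [d']) (fun h => by simp [l'])
  have hJ : (1 - C T * kFraction d' l') * jFraction d l = 1 :=
    hK ▸ one_sub_kFraction_mul_jFraction d l
  ext n
  have hIE := congrArg (coeff n)
    (mk_sum_IE_eq_jFraction (Polynomial.C x) (Polynomial.C v) (Polynomial.C w) T)
  rw [coeff_mk] at hIE
  rw [coeff_mk, ← coeff_one_sum_IE, hIE, coeff_one_coeff_of_one_sub_C_X_mul hJ, map_kFraction]
  refine congrArg (coeff n) (kFraction_congr (fun h => ?_) fun h => ?_)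
  · cases h <;> simp [d', d, T, mul_comm]
  · cases h <;> simp [l', l, T]

theorem mk_sum_CIE_eq_C_mul_kFraction :
    PowerSeries.mk (fun n => ∑ π ∈ CIE n, x ^ fp π * v ^ exc π * w ^ dexc π * t ^ cyc π) =
      C t * kFraction (fun h => if h = 1 then v else ((h : R) - 1) * v)
        (fun h => if h = 0 then x else v * w + (h : R)) := by
  rw [← mk_sum_CIE_eq_kFraction]
  ext n
  rw [coeff_C_mul, coeff_mk, coeff_mk, Finset.mul_sum]
  refine Finset.sum_congr rfl fun π hπ => ?_
  rw [cyc_eq_one_of_mem_CIE hπ, pow_one, mul_comm]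

theorem CIE_zero : CIE 0 = ∅ :=
  Finset.eq_empty_of_forall_notMem fun π hπ =>
    zero_ne_one ((cyc_eq_zero π).symm.trans (cyc_eq_one_of_mem_CIE hπ))

theorem mk_card_CIE_eq_kFraction :
    PowerSeries.mk (fun n => ((CIE n).card : R)) =
      kFraction (fun h => if h = 1 then 1 else (h : R) - 1) (fun h => (h : R) + 1) := by
  calc PowerSeries.mk (fun n => ((CIE n).card : R))
      = kFraction (fun h => if h = 1 then 1 else ((h : R) - 1) * 1)
          (fun h => if h = 0 then 1 else 1 * 1 + (h : R)) := by
        simpa using mk_sum_CIE_eq_kFraction (1 : R) 1 1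
    _ = _ := kFraction_congr (fun h => by rw [mul_one]) fun h => by
        cases h <;> simp [add_comm]

end GeneratingFunctions

end PermStat

open PermStat in
/-- Formal variables are covered by `R = ℤ[x, v, w, t]`; the variable `z` is `PowerSeries.X`. -/
theorem mainTheorem6 {R : Type*} [CommRing R] (x v w t : R) :
    PowerSeries.mk (fun n => ∑ π ∈ IE n, x ^ fp π * v ^ exc π * w ^ dexc π * t ^ cyc π) =
      jFraction (fun h => v * ((h : R) - 1 + t))
        (fun h => if h = 0 then x * t else x * t + v * w + (h : R)) ∧
    PowerSeries.mk (fun n => ∑ π ∈ CIE n, x ^ fp π * v ^ exc π * w ^ dexc π) =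
      kFraction (fun h => if h = 1 then v else ((h : R) - 1) * v)
        (fun h => if h = 0 then x else v * w + (h : R)) ∧
    PowerSeries.mk (fun n => ∑ π ∈ CIE n, x ^ fp π * v ^ exc π * w ^ dexc π * t ^ cyc π) =
      PowerSeries.C t * kFraction (fun h => if h = 1 then v else ((h : R) - 1) * v)
        (fun h => if h = 0 then x else v * w + (h : R)) ∧
    PowerSeries.mk (fun n => if 1 ≤ n then ((CIE n).card : ℤ) else 0) =
      kFraction (fun h => if h = 1 then 1 else (h : ℤ) - 1) (fun h => (h : ℤ) + 1) := by
  refine ⟨mk_sum_IE_eq_jFraction x v w t, mk_sum_CIE_eq_kFraction x v w,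
    mk_sum_CIE_eq_C_mul_kFraction x v w t, ?_⟩
  rw [← mk_card_CIE_eq_kFraction]
  ext n
  cases n <;> simp [CIE_zero]
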